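/- Work over $\mathbb C$. Let $\mathrm{CVir}=\mathbb C[\partial]L$ be the Virasoro conformal algebra, the free $\mathbb C[\partial]$-module on $L$ with $\lambda$-bracket determined by $[L_\lambda L]=(\partial+2\lambda)L$. A Virasoro element of a Lie conformal algebra is a nonzero element $x$ with $[x_\lambda x]=(\partial+2\lambda)x$. For a conformal module $V$ over a Lie conformal algebra $R$ and a Virasoro element $x\in R$, the action of $x$ on $V$ is called regular if $V$ has a $\mathbb C[\partial]$-basis $Y$ (a regular basis for $x$) such that for every $y\in Y$ there are $\Delta^x_y,\alpha^x_y\in\mathbb C$ with $x_\lambda y=(\partial+\Delta^x_y\lambda+\alpha^x_y)y$. Let $\Gamma$ be the set of Virasoro elements of $R$ whose action on $V$ is regular. When $\Gamma$ and the regular bases $Y_x$ ($x\in\Gamma$) are finite, the conformal weight product of $V$ is $p=\prod_{x\in\Gamma}\prod_{y\in Y_x}\Delta^x_y$. A conformal module is irreducible if it is nonzero and has no conformal submodules other than $0$ and itself; it is trivial if every $a_\lambda$ acts on it as zero; it is semisimple if it is a direct sum of irreducible conformal submodules. Theorem. The element $L$ is the unique Virasoro element of $\mathrm{CVir}$. Let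 $V$ be a conformal module over $\mathrm{CVir}$ that is finitely generated over $\mathbb C[\partial]$. If the action of $L$ on $V$ is regular, then the conformal weight product $p$ of $V$ is defined and does not depend on the choice of the regular basis. Moreover, $V$ is semisimple without trivial irreducible submodules (equivalently, $V$ is a direct sum of non-trivial irreducible conformal submodules) if and only if the action of $L$ on $V$ is regular and $p\neq 0$. -/

import Mathlib

open Polynomial

noncomputable section

/-! Complex `∂`-modules are modules over `ℂ[X]`, the variable `X` acting as `∂`.
The space `ℂ[λ] ⊗ V` of polynomials in `λ` with coefficients in `V` is `PolynomialModule ℂ V`.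
An element of `ℂ[λ] ⊗ V` or `ℂ[λ, μ] ⊗ V` is determined by its values at all complex
`λ`, `μ` (the field is infinite), so identities in `λ` and `μ` are stated by evaluation. -/

/-- A Lie conformal algebra: a `ℂ[∂]`-module with a `λ`-bracket that is sesquilinear,
skew-symmetric and satisfies the Jacobi identity. -/
class LieConformalAlgebra (R : Type*) [AddCommGroup R] [Module ℂ R] [Module ℂ[X] R]
    [IsScalarTower ℂ ℂ[X] R] where
  /-- The `λ`-bracket `a ⊗ b ↦ [a_λ b]`. -/
  bracket : R →ₗ[ℂ] R →ₗ[ℂ] PolynomialModule ℂ R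
  /-- `[∂a_λ b] = -λ [a_λ b]` -/
  bracket_d_left : ∀ (a b : R) (l : ℂ),
    (bracket ((X : ℂ[X]) • a) b).eval l = (-l) • (bracket a b).eval l
  /-- `[a_λ ∂b] = (∂ + λ) [a_λ b]` -/
  bracket_d_right : ∀ (a b : R) (l : ℂ),
    (bracket a ((X : ℂ[X]) • b)).eval l = (X + C l : ℂ[X]) • (bracket a b).eval l
  /-- `[a_λ b] = -[b_{-λ-∂} a]`: if `[b_μ a] = ∑ μⁿ cₙ`, the right side is `-∑ (-λ-∂)ⁿ cₙ`. -/
  bracket_skew : ∀ (a b : R) (l : ℂ),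
    (bracket a b).eval l = -((bracket b a).coeff.sum fun n c => (-C l - X : ℂ[X]) ^ n • c)
  /-- `[a_λ [b_μ c]] = [[a_λ b]_{λ+μ} c] + [b_μ [a_λ c]]` -/
  bracket_jacobi : ∀ (a b c : R) (l m : ℂ),
    (bracket a ((bracket b c).eval m)).eval l =
      (bracket ((bracket a b).eval l) c).eval (l + m) +
        (bracket b ((bracket a c).eval l)).eval m

/-- A conformal module over a Lie conformal algebra. -/
class ConformalModule (R : Type*) [AddCommGroup R] [Module ℂ R] [Module ℂ[X] R]
    [IsScalarTower ℂ ℂ[X] R] [LieConformalAlgebra R]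
    (V : Type*) [AddCommGroup V] [Module ℂ V] [Module ℂ[X] V] [IsScalarTower ℂ ℂ[X] V] where
  /-- The `λ`-action `a ⊗ v ↦ a_λ v`. -/
  act : R →ₗ[ℂ] V →ₗ[ℂ] PolynomialModule ℂ V
  /-- `(∂a)_λ v = -λ a_λ v` -/
  act_d_left : ∀ (a : R) (v : V) (l : ℂ),
    (act ((X : ℂ[X]) • a) v).eval l = (-l) • (act a v).eval l
  /-- `a_λ (∂v) = (∂ + λ) a_λ v` -/
  act_d_right : ∀ (a : R) (v : V) (l : ℂ),
    (act a ((X : ℂ[X]) • v)).eval l = (X + C l : ℂ[X]) • (act a v).eval l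
  /-- `[a_λ b]_{λ+μ} v = a_λ (b_μ v) - b_μ (a_λ v)` -/
  act_bracket : ∀ (a b : R) (v : V) (l m : ℂ),
    (act ((LieConformalAlgebra.bracket a b).eval l) v).eval (l + m) =
      (act a ((act b v).eval m)).eval l - (act b ((act a v).eval l)).eval m

namespace ConformalModule

section General

variable (R : Type*) [AddCommGroup R] [Module ℂ R] [Module ℂ[X] R]
    [IsScalarTower ℂ ℂ[X] R] [LieConformalAlgebra R]

variable {R} in
/-- A Virasoro element: a nonzero `L` with `[L_λ L] = (∂ + 2λ) L`. -/
def IsVirasoroElement (L : R) : Prop :=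
  L ≠ 0 ∧ ∀ l : ℂ, (LieConformalAlgebra.bracket L L).eval l = (X + C (2 * l) : ℂ[X]) • L

variable {V : Type*} [AddCommGroup V] [Module ℂ V] [Module ℂ[X] V]
    [IsScalarTower ℂ ℂ[X] V] [ConformalModule R V]

/-- A `ℂ[∂]`-submodule `N` is a conformal submodule if `a_λ v ∈ ℂ[λ] ⊗ N` for `v ∈ N`. -/
def IsConformalSubmodule (N : Submodule ℂ[X] V) : Prop :=
  ∀ (a : R), ∀ v ∈ N, ∀ n : ℕ, (act a v).coeff n ∈ N

/-- `N` is an irreducible (simple) conformal submodule: it is nonzero, and its only conformal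
submodules are zero and itself. A trivial action is not excluded here. -/
def IsIrreducibleSubmodule (N : Submodule ℂ[X] V) : Prop :=
  IsConformalSubmodule R N ∧ N ≠ ⊥ ∧
    ∀ M : Submodule ℂ[X] V, IsConformalSubmodule R M → M ≤ N → M = ⊥ ∨ M = N

/-- The algebra acts trivially on `N`: `a_λ v = 0` for all `a` and all `v ∈ N`. -/
def IsTrivialOn (N : Submodule ℂ[X] V) : Prop :=
  ∀ (a : R), ∀ v ∈ N, act a v = 0

variable (V) in
/-- `V` is semisimple: the (internal) direct sum of a set of irreducible conformal submodules. -/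
def IsSemisimple : Prop :=
  ∃ S : Set (Submodule ℂ[X] V),
    (∀ N ∈ S, IsIrreducibleSubmodule R N) ∧ sSupIndep S ∧ sSup S = ⊤

variable {R}

variable (V) in
/-- A `ℂ[∂]`-basis `Y` of `V` on which `L` acts by `L_λ y = (∂ + Δ_y λ + α_y) y`,
with the conformal weights `Δ_y` and the conformal shifts `α_y`. -/
structure RegularBasis (L : R) where
  /-- The basis, as a subset of `V`. -/
  carrier : Set V
  /-- The proof that the subset is a basis over `ℂ[∂]`. -/
  basis : Module.Basis carrier ℂ[X] V
  basis_apply : ∀ y : carrier, basis y = y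
  /-- The conformal weights `Δ_y`. -/
  weight : carrier → ℂ
  /-- The conformal shifts `α_y`. -/
  shift : carrier → ℂ
  act_eq : ∀ (y : carrier) (l : ℂ),
    (act L (y : V)).eval l = (X + C (weight y * l + shift y) : ℂ[X]) • (y : V)

variable (V) in
/-- The action of `L` on `V` is regular. -/
def IsRegularAction (L : R) : Prop := Nonempty (RegularBasis V L)

variable (R V) in
/-- The set `Γ` of Virasoro elements with regular action on `V`. -/
def regularVirasoroElements : Set R :=
  {L | IsVirasoroElement L ∧ IsRegularAction V L}

variable (R V) in
/-- `p` is the conformal weight product `∏_{L ∈ Γ} ∏_{y ∈ Y} Δ_y^L` of `V`, computed with some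
choice of regular bases `Y = Y_L`; `Γ` and the bases have to be finite. -/
def IsConformalWeightProduct (p : ℂ) : Prop :=
  (regularVirasoroElements R V).Finite ∧
  ∃ Y : ∀ L : regularVirasoroElements R V, RegularBasis V (L : R),
    (∀ L, (Y L).carrier.Finite) ∧
    p = ∏ᶠ L : regularVirasoroElements R V, ∏ᶠ y : (Y L).carrier, (Y L).weight y

end General

end ConformalModule

/-- The Virasoro conformal algebra `ℂ[∂]L`, free of rank one over `ℂ[∂]`: the polynomial `f`
stands for `f(∂)L`. -/
def CVir : Type := ℂ[X]

namespace CVir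

instance : AddCommGroup CVir := inferInstanceAs (AddCommGroup ℂ[X])
instance : Module ℂ CVir := inferInstanceAs (Module ℂ ℂ[X])
instance : Module ℂ[X] CVir := inferInstanceAs (Module ℂ[X] ℂ[X])
instance : IsScalarTower ℂ ℂ[X] CVir := inferInstanceAs (IsScalarTower ℂ ℂ[X] ℂ[X])

/-- The generator `L`. -/
def L : CVir := (1 : ℂ[X])

/-- The bracket `[f(∂)L _λ g(∂)L] = f(-λ) g(∂ + λ) (∂ + 2λ) L` as a polynomial in `λ` (the outer
variable) over `ℂ[∂]`; it extends `[L_λ L] = (∂ + 2λ)L` sesquilinearly. -/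
def bracketPoly : ℂ[X] →ₗ[ℂ] ℂ[X] →ₗ[ℂ] ℂ[X][X] :=
  (LinearMap.mul ℂ ℂ[X][X]).compl₁₂
    (aeval (-X : ℂ[X][X])).toLinearMap
    ((LinearMap.mulRight ℂ (C X + 2 * X : ℂ[X][X])).comp
      (aeval (C X + X : ℂ[X][X])).toLinearMap)

/-- The bracket on `ℂ[∂]`, with values in polynomials in `λ`. -/
def polyBracket : ℂ[X] →ₗ[ℂ] ℂ[X] →ₗ[ℂ] PolynomialModule ℂ ℂ[X] :=
  bracketPoly.compr₂
    ((PolynomialModule.equivPolynomial (R := ℂ) (S := ℂ[X])).symm :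
      ℂ[X][X] →ₗ[ℂ] PolynomialModule ℂ ℂ[X])

theorem sum_equivPolynomial_symm (F : ℂ[X][X]) (q : ℂ[X]) :
    ((PolynomialModule.equivPolynomial (R := ℂ) (S := ℂ[X])).symm F).coeff.sum
      (fun n c => q ^ n • c) = F.eval q := by
  induction F using Polynomial.induction_on' with
  | add p r hp hr =>
    rw [map_add, PolynomialModule.coeff_add, Polynomial.eval_add, ← hp, ← hr]
    exact Finsupp.sum_add_index' (fun _ => smul_zero _) fun _ _ _ => smul_add _ _ _
  | monomial n c =>
    rw [PolynomialModule.equivPolynomial_symm_monomial, PolynomialModule.coeff_single,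
      Polynomial.eval_monomial, mul_comm]
    exact Finsupp.sum_single_index (smul_zero _)

theorem eval_equivPolynomial_symm (F : ℂ[X][X]) (l : ℂ) :
    ((PolynomialModule.equivPolynomial (R := ℂ) (S := ℂ[X])).symm F).eval l =
      F.eval (C l) := by
  rw [← sum_equivPolynomial_symm]
  refine Finsupp.sum_congr fun n _ => ?_
  rw [← C_pow, smul_eq_mul, ← smul_eq_C_mul]

theorem eval_bracketPoly (f g q : ℂ[X]) :
    (bracketPoly f g).eval q = f.comp (-q) * (g.comp (X + q) * (X + 2 * q)) := by
  have h (f : ℂ[X]) (G : ℂ[X][X]) : (aeval G f).eval q = f.comp (G.eval q) := by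
    induction f using Polynomial.induction_on' with
    | add p r hp hr => simp [hp, hr]
    | monomial n c =>
      simp [Polynomial.aeval_monomial, IsScalarTower.algebraMap_apply ℂ ℂ[X] ℂ[X][X]]
  simp [bracketPoly, h]

theorem eval_polyBracket (f g : ℂ[X]) (l : ℂ) :
    (polyBracket f g).eval l = f.comp (-C l) * (g.comp (X + C l) * (X + 2 * C l)) :=
  (eval_equivPolynomial_symm _ _).trans (eval_bracketPoly _ _ _)

theorem sum_polyBracket (f g q : ℂ[X]) :
    (polyBracket f g).coeff.sum (fun n c => q ^ n • c) =
      f.comp (-q) * (g.comp (X + q) * (X + 2 * q)) :=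
  (sum_equivPolynomial_symm _ _).trans (eval_bracketPoly _ _ _)

theorem polyBracket_d_left (f g : ℂ[X]) (l : ℂ) :
    (polyBracket ((X : ℂ[X]) • f) g).eval l = (-l) • (polyBracket f g).eval l := by
  rw [eval_polyBracket, eval_polyBracket, smul_eq_C_mul, smul_eq_mul, mul_comp, X_comp, C_neg]
  ring

theorem polyBracket_d_right (f g : ℂ[X]) (l : ℂ) :
    (polyBracket f ((X : ℂ[X]) • g)).eval l = (X + C l : ℂ[X]) • (polyBracket f g).eval l := by
  rw [eval_polyBracket, eval_polyBracket, smul_eq_mul, smul_eq_mul, mul_comp, X_comp]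
  ring

theorem polyBracket_skew (f g : ℂ[X]) (l : ℂ) :
    (polyBracket f g).eval l =
      -((polyBracket g f).coeff.sum fun n c => (-C l - X : ℂ[X]) ^ n • c) := by
  have h1 : -(-C l - X : ℂ[X]) = X + C l := by ring
  have h2 : (X + (-C l - X) : ℂ[X]) = -C l := by ring
  rw [sum_polyBracket, eval_polyBracket, h1, h2]
  ring

theorem polyBracket_jacobi (f g h : ℂ[X]) (l m : ℂ) :
    (polyBracket f ((polyBracket g h).eval m)).eval l =
      (polyBracket ((polyBracket f g).eval l) h).eval (l + m) +
        (polyBracket g ((polyBracket f h).eval l)).eval m := by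
  have h1 : (-(C l + C m) + C l : ℂ[X]) = -C m := by ring
  have h2 : (X + C l + C m : ℂ[X]) = X + (C l + C m) := by ring
  have h3 : (X + C m + C l : ℂ[X]) = X + (C l + C m) := by ring
  simp only [eval_polyBracket, mul_comp, add_comp, neg_comp, comp_assoc, X_comp, C_comp, map_add,
    h1, h2, h3, ofNat_comp]
  ring

instance : LieConformalAlgebra CVir where
  bracket := polyBracket
  bracket_d_left := polyBracket_d_left
  bracket_d_right := polyBracket_d_right
  bracket_skew := polyBracket_skew
  bracket_jacobi := polyBracket_jacobi

/-- The defining relation `[L_λ L] = (∂ + 2λ) L`. -/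
theorem bracket_L_L (l : ℂ) :
    (LieConformalAlgebra.bracket L L).eval l = (X + C (2 * l) : ℂ[X]) • L := by
  have h : (polyBracket 1 1).eval l = (X + C (2 * l) : ℂ[X]) • (1 : ℂ[X]) := by
    rw [eval_polyBracket, one_comp, one_comp, one_mul, one_mul, smul_eq_mul, mul_one, C_mul]
    rfl
  exact h

end CVir

end

/-! Since `L` generates `CVir` over `ℂ[∂]`, a conformal module is governed by the coefficients of
`L_λ v = ∑ λⁿ aₙ v`; their relations are collected in `IsVirasoroAction`.

The core is `exists_generator_of_irreducible`: a non-trivial irreducible finite module is `ℂ[∂]v`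
with `L_λ v = (∂ + wλ + s)v` and `w ≠ 0`. The spaces `level a n` increase with `n`; at the first
non-zero one, `level a (n + 1)`, vectors independent over `ℂ` stay independent over `ℂ[∂]`, so this
space is finite-dimensional and has eigenvectors. The operator `a₀ - ∂` commutes with the action,
hence is a scalar `s`; a trace argument gives `n ≤ 1`; an eigenvector of `a₁` generates the module;
eigenvalue `0` would make `(∂ + s)v` generate a proper submodule. Generators of the summands of a
semisimple module then form a regular basis with non-zero weights
(`exists_regularBasis_of_isSemisimple`).

Conversely, if `w ≠ 0`, the top coefficient of `L_λ(p(∂)v) = p(∂ + λ)L_λ v` is a non-zero multiple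
of `v`, so `ℂ[∂]v` is irreducible and a regular basis with non-zero weights splits the module.

The product of the weights is the top `λ`-coefficient of a determinant that a change of regular
basis preserves (`prod_weight_eq`). -/

/-! ### Coefficient operators of a Virasoro action -/

section CoefficientOperators

variable {W : Type*} [AddCommGroup W] [Module ℂ W] [Module ℂ[X] W] [IsScalarTower ℂ ℂ[X] W]

/-- The operators `a n` behave as the coefficients of `L_λ v = ∑ λⁿ aₙ v` in a conformal module
over the Virasoro conformal algebra. -/
structure IsVirasoroAction (a : ℕ → W →ₗ[ℂ] W) : Prop where
  eventually_zero : ∀ v, ∃ n, ∀ m, n ≤ m → a m v = 0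
  zero_X_smul : ∀ v, a 0 ((X : ℂ[X]) • v) = (X : ℂ[X]) • a 0 v
  succ_X_smul : ∀ n v, a (n + 1) ((X : ℂ[X]) • v) = (X : ℂ[X]) • a (n + 1) v + a n v
  commutator : ∀ i j v, a i (a j v) - a j (a i v) =
    (((i + j - 1).choose j : ℂ) - ((i + j - 1).choose i : ℂ)) • a (i + j - 1) v

namespace IsVirasoroAction

/-- The vectors killed by `a m` for all `m ≥ n`. -/
def level (a : ℕ → W →ₗ[ℂ] W) (n : ℕ) : Submodule ℂ W where
  carrier := {v | ∀ m, n ≤ m → a m v = 0}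
  zero_mem' m _ := map_zero _
  add_mem' hv hw m hm := by rw [map_add, hv m hm, hw m hm, add_zero]
  smul_mem' c v hv m hm := by rw [map_smul, hv m hm, smul_zero]

/-- A `ℂ[∂]`-submodule that is stable under all operators `a n`. -/
def IsStable (a : ℕ → W →ₗ[ℂ] W) (M : Submodule ℂ[X] W) : Prop :=
  ∀ n, ∀ v ∈ M, a n v ∈ M

variable {a : ℕ → W →ₗ[ℂ] W} (ha : IsVirasoroAction a)
include ha

/-- The top coefficient of `L_λ (p(∂) v) = p(∂ + λ) L_λ v`. -/
theorem apply_smul_top {n d : ℕ} {v : W} (hv : v ∈ level a (n + 1)) (p : ℂ[X])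
    (hp : p.natDegree ≤ d) :
    a (n + d) (p • v) = p.coeff d • a n v ∧ p • v ∈ level a (n + d + 1) := by
  induction d generalizing p with
  | zero =>
    rw [Polynomial.eq_C_of_natDegree_le_zero hp, ← algebraMap_eq, algebraMap_smul]
    refine ⟨by simp, Submodule.smul_mem _ _ hv⟩
  | succ d ih =>
    obtain ⟨h1, h2⟩ := ih p.divX (by rw [natDegree_divX_eq_natDegree_tsub_one]; omega)
    have hpv : p • v = (X : ℂ[X]) • p.divX • v + p.coeff 0 • v := by
      conv_lhs => rw [← p.X_mul_divX_add, add_smul, mul_smul, ← algebraMap_eq, algebraMap_smul]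
    rw [hpv]
    constructor
    · rw [map_add, ← add_assoc n d 1, ha.succ_X_smul, h2 _ le_rfl, h1, map_smul,
        hv (n + d + 1) (by omega), smul_zero, smul_zero, zero_add, add_zero, coeff_divX]
    · intro m hm
      obtain ⟨m, rfl⟩ : ∃ k, m = k + 1 := ⟨m - 1, by omega⟩
      rw [map_add, ha.succ_X_smul, h2 _ (by omega), h2 _ (by omega), map_smul,
        hv _ (by omega), smul_zero, smul_zero, zero_add, add_zero]

/-- A vector whose top coefficient does not vanish is not a torsion vector. -/
theorem smul_ne_zero_of_level {n : ℕ} {v : W} (hv : v ∈ level a (n + 1)) (hn : a n v ≠ 0)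
    {p : ℂ[X]} (hp : p ≠ 0) : p • v ≠ 0 := fun h => by
  have h1 := (ha.apply_smul_top hv p le_rfl).1
  rw [h, map_zero, eq_comm, smul_eq_zero] at h1
  exact h1.elim (by simpa using hp) hn

/-- The vectors killed by the whole action form a stable submodule. -/
theorem exists_stable_coe_eq_level_zero :
    ∃ M : Submodule ℂ[X] W, IsStable a M ∧ ∀ v, v ∈ M ↔ v ∈ level a 0 := by
  have hX : ∀ v ∈ level a 0, (X : ℂ[X]) • v ∈ level a 0 := fun v hv m _ => by
    cases m with
    | zero => rw [ha.zero_X_smul, hv 0 le_rfl, smul_zero]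
    | succ m => rw [ha.succ_X_smul, hv _ (by omega), hv _ (by omega), smul_zero, zero_add]
  refine ⟨{ (level a 0) with
    smul_mem' := fun p v hv => ?_ }, ?_, fun v => Iff.rfl⟩
  · change p • v ∈ level a 0
    induction p using Polynomial.induction_on with
    | C c => rw [← algebraMap_eq, algebraMap_smul]; exact Submodule.smul_mem _ _ hv
    | add p q hp hq => rw [add_smul]; exact Submodule.add_mem _ hp hq
    | monomial n c h => rw [pow_succ', mul_left_comm, mul_smul]; exact hX _ h
  · intro n v hv
    rw [hv n (Nat.zero_le _)]
    exact Submodule.zero_mem _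

-- In other words `a₀ - ∂` commutes with every `aₙ`: both `[aₙ, a₀]` and `[aₙ, ∂]` equal `aₙ₋₁`.
-- This makes its eigenspaces stable.
omit [IsScalarTower ℂ ℂ[X] W] in
theorem apply_zero_comm (n : ℕ) (v : W) :
    a n (a 0 v) = a 0 (a n v) + a n ((X : ℂ[X]) • v) - (X : ℂ[X]) • a n v := by
  cases n with
  | zero => rw [ha.zero_X_smul]; abel
  | succ n =>
    have h := ha.commutator (n + 1) 0 v
    have h2 : n.choose (n + 1) = 0 := Nat.choose_succ_self n
    simp only [add_zero, Nat.add_sub_cancel, Nat.choose_zero_right, h2, Nat.cast_one,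
      Nat.cast_zero, sub_zero, one_smul] at h
    rw [ha.succ_X_smul, ← h]
    abel

/-- The kernel of `∂ - a₀ - c` is a stable submodule. -/
theorem exists_stable_eigenspace (c : ℂ) :
    ∃ M : Submodule ℂ[X] W, IsStable a M ∧ ∀ v, v ∈ M ↔ a 0 v = (X : ℂ[X]) • v + c • v := by
  have hX : ∀ v, a 0 v = (X : ℂ[X]) • v + c • v →
      a 0 ((X : ℂ[X]) • v) = (X : ℂ[X]) • (X : ℂ[X]) • v + c • (X : ℂ[X]) • v := fun v hv => by
    rw [ha.zero_X_smul, hv, smul_add, smul_comm c]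
  have hadd : ∀ v w, a 0 v = (X : ℂ[X]) • v + c • v → a 0 w = (X : ℂ[X]) • w + c • w →
      a 0 (v + w) = (X : ℂ[X]) • (v + w) + c • (v + w) := fun v w hv hw => by
    rw [map_add, hv, hw, smul_add, smul_add]; abel
  refine ⟨{
    carrier := {v | a 0 v = (X : ℂ[X]) • v + c • v}
    zero_mem' := by simp
    add_mem' := fun {v w} => hadd v w
    smul_mem' := fun p v hv => ?_ }, ?_, fun v => Iff.rfl⟩
  · induction p using Polynomial.induction_on with
    | C d =>
      rw [Set.mem_ofPred_eq] at hv ⊢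
      rw [← algebraMap_eq, algebraMap_smul, map_smul, hv, smul_add, smul_comm d c,
        smul_comm d (X : ℂ[X])]
    | add p q hp hq => rw [add_smul]; exact hadd _ _ hp hq
    | monomial n d h => rw [pow_succ', mul_left_comm, mul_smul]; exact hX _ h
  · intro n v hv
    change a 0 v = _ at hv
    change a 0 (a n v) = _
    have h := ha.apply_zero_comm n v
    rw [hv, map_add, (a n).map_smul] at h
    rw [← sub_eq_zero] at h ⊢
    rw [← neg_eq_zero, ← h]
    abel

-- The commutator of `aₘ` and `aᵢ` is a multiple of `aₘ₊ᵢ₋₁`, whose index is at least `m` once `i ≥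
-- 1`.
omit [IsScalarTower ℂ ℂ[X] W] in
theorem apply_mem_level {n i : ℕ} (hi : 1 ≤ i) {v : W} (hv : v ∈ level a n) :
    a i v ∈ level a n := fun m hm => by
  have h := ha.commutator m i v
  rwa [hv m hm, map_zero, sub_zero, hv (m + i - 1) (by omega), smul_zero] at h

/-- If `n` is minimal with `level a (n + 1) ≠ 0`, this space has finite dimension. -/
theorem finiteDimensional_level [Module.Finite ℂ[X] W] {n : ℕ} (hn : level a n = ⊥) :
    FiniteDimensional ℂ (level a (n + 1)) := by
  let b := Module.Basis.ofVectorSpace ℂ (level a (n + 1))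
  have hli : LinearIndependent ℂ[X] fun i => (b i : W) := by
    rw [linearIndependent_iff']
    intro s g hg i hi
    by_contra hne
    set d := s.sup fun j => (g j).natDegree with hd
    have hle : ∀ j ∈ s, (g j).natDegree ≤ d := fun j hj =>
      Finset.le_sup (f := fun j => (g j).natDegree) hj
    -- Applying `a (n + d)` to the relation extracts its degree-`d` coefficients, so their
    -- combination of the `b j` is killed by `a n` as well and lies in `level a n = ⊥`.
    have key : a n (∑ j ∈ s, (g j).coeff d • (b j : W)) = 0 := by
      rw [map_sum]
      have := congrArg (a (n + d)) hg
      rw [map_zero, map_sum] at this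
      rw [← this]
      exact Finset.sum_congr rfl fun j hj => by
        rw [map_smul, (ha.apply_smul_top (b j).2 (g j) (hle j hj)).1]
    have hmem : ∑ j ∈ s, (g j).coeff d • (b j : W) ∈ level a n := fun m hm => by
      rcases hm.eq_or_lt with rfl | hm
      · exact key
      · exact Submodule.sum_mem _ (fun j _ => Submodule.smul_mem _ _ (b j).2) m hm
    rw [hn, Submodule.mem_bot] at hmem
    have hb := linearIndependent_iff'.1 b.linearIndependent s (fun j => (g j).coeff d)
      (Subtype.ext (by simpa using hmem))
    -- Some `g j` attains the degree `d`, and its leading coefficient vanishes; hence `d = 0` and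
    -- all the `g j` are constants equal to their vanishing coefficient.
    obtain ⟨j, hj, hjd⟩ := Finset.exists_mem_eq_sup s ⟨i, hi⟩ fun j => (g j).natDegree
    have hj0 : g j = 0 := by
      have := hb j hj
      rw [hd, hjd] at this
      exact leadingCoeff_eq_zero.1 this
    have hd0 : d = 0 := by rw [hd, hjd, hj0, natDegree_zero]
    have h0 := hb i hi
    have hi0 := hle i hi
    rw [hd0] at h0 hi0
    exact hne (by rw [Polynomial.eq_C_of_natDegree_le_zero hi0]; simpa using h0)
  have := hli.finite_of_isNoetherian
  exact Module.Finite.of_basis b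

theorem isStable_span_singleton {u : W} (hu : ∀ m, a m u ∈ Submodule.span ℂ[X] {u}) :
    IsStable a (Submodule.span ℂ[X] {u}) := fun m x hx => by
  obtain ⟨p, rfl⟩ := Submodule.mem_span_singleton.1 hx
  clear hx
  induction p using Polynomial.induction_on generalizing m with
  | C d =>
    rw [← algebraMap_eq, algebraMap_smul, map_smul]
    exact Submodule.smul_of_tower_mem _ _ (hu m)
  | add p q hp hq => rw [add_smul, map_add]; exact Submodule.add_mem _ (hp m) (hq m)
  | monomial k d h =>
    rw [pow_succ', mul_left_comm, mul_smul]
    cases m with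
    | zero => rw [ha.zero_X_smul]; exact Submodule.smul_mem _ _ (h 0)
    | succ m =>
      rw [ha.succ_X_smul]
      exact Submodule.add_mem _ (Submodule.smul_mem _ _ (h _)) (h _)

/-- The classification of irreducible modules of finite rank. -/
theorem exists_generator_of_irreducible [Module.Finite ℂ[X] W] (hne : ∃ n v, a n v ≠ 0)
    (hirr : ∀ M : Submodule ℂ[X] W, IsStable a M → M = ⊥ ∨ M = ⊤) :
    ∃ (v : W) (w s : ℂ), w ≠ 0 ∧ v ≠ 0 ∧ Submodule.span ℂ[X] {v} = ⊤ ∧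
      a 0 v = (X : ℂ[X]) • v + s • v ∧ a 1 v = w • v ∧ v ∈ level a 2 := by
  have h0 : level a 0 = ⊥ := by
    obtain ⟨M, hM, hMl⟩ := ha.exists_stable_coe_eq_level_zero
    rcases hirr M hM with rfl | rfl
    · exact (Submodule.eq_bot_iff _).2 fun v hv => by simpa using (hMl v).2 hv
    · obtain ⟨n, v, hv⟩ := hne
      exact absurd ((hMl v).1 trivial n (Nat.zero_le _)) hv
  have hex : ∃ n, level a n ≠ ⊥ := by
    obtain ⟨n, v, hv⟩ := hne
    obtain ⟨N, hN⟩ := ha.eventually_zero v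
    exact ⟨N, (Submodule.ne_bot_iff _).2 ⟨v, hN, fun h => hv (by rw [h, map_zero])⟩⟩
  obtain ⟨n, hbot, hlev⟩ : ∃ n, level a n = ⊥ ∧ level a (n + 1) ≠ ⊥ := by
    by_contra! hcon
    obtain ⟨n, hn⟩ := hex
    exact hn (Nat.rec h0 (fun k hk => hcon k hk) n)
  have := ha.finiteDimensional_level hbot
  have := Submodule.nontrivial_iff_ne_bot.2 hlev
  -- the action of `a 0`
  obtain ⟨s, hs⟩ : ∃ s : ℂ, ∀ v, a 0 v = (X : ℂ[X]) • v + s • v := by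
    -- Schur's lemma for `a₀ - ∂`: an eigenvalue exists on the finite-dimensional level, and its
    -- eigenspace in `W` is a non-zero stable submodule, hence everything.
    let T : W →ₗ[ℂ] W := a 0 - Module.toModuleEnd ℂ W (X : ℂ[X])
    have hT : ∀ v, T v = a 0 v - (X : ℂ[X]) • v := fun v => rfl
    have hTl : ∀ v ∈ level a (n + 1), T v ∈ level a (n + 1) := fun v hv m hm => by
      rw [hT, map_sub, ha.apply_zero_comm, hv m hm]
      simp
    obtain ⟨s, hs⟩ := Module.End.exists_eigenvalue (T.restrict hTl)
    obtain ⟨⟨v, hv⟩, hvs⟩ := hs.exists_hasEigenvector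
    have h1 : T v = s • v := congrArg Subtype.val hvs.apply_eq_smul
    have h2 : v ≠ 0 := fun h => hvs.2 (Subtype.ext h)
    obtain ⟨M, hM, hMs⟩ := ha.exists_stable_eigenspace s
    rcases hirr M hM with rfl | rfl
    · refine absurd ((Submodule.mem_bot _).1 ((hMs v).2 ?_)) h2
      rw [← h1, hT]; abel
    · exact ⟨s, fun v => (hMs v).1 trivial⟩
  -- If `n ≥ 2`, then `[a₁, aₙ] = (1 - n)aₙ` on `level a (n + 1)`, where `aₙ` is injective because
  -- `level a n = ⊥`. Multiplying by `aₙ⁻¹` and taking traces gives `0 = (1 - n) dim`, which is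
  -- impossible.
  have hn : n ≤ 1 := by
    by_contra! hn
    let A := (a 1).restrict fun v (hv : v ∈ level a (n + 1)) => ha.apply_mem_level le_rfl hv
    let B := (a n).restrict fun v (hv : v ∈ level a (n + 1)) => ha.apply_mem_level hn.le hv
    have hAB : A * B - B * A = (1 - n : ℂ) • B := by
      ext v
      have h := ha.commutator 1 n v
      simpa [A, B] using h
    have hB : IsUnit B := by
      rw [LinearMap.isUnit_iff_ker_eq_bot, LinearMap.ker_eq_bot']
      intro v hv
      have : (v : W) ∈ level a n := fun m hm => by
        rcases hm.eq_or_lt with rfl | hm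
        · exact congrArg Subtype.val hv
        · exact v.2 m hm
      rw [hbot, Submodule.mem_bot] at this
      exact Subtype.ext this
    obtain ⟨U, hU⟩ := hB
    have htr : LinearMap.trace ℂ _ ((A * B - B * A) * ((U⁻¹ : (Module.End ℂ (level a (n + 1)))ˣ) :
        Module.End ℂ (level a (n + 1)))) =
        (1 - n : ℂ) * Module.finrank ℂ (level a (n + 1)) := by
      rw [hAB, ← hU, smul_mul_assoc, Units.mul_inv, map_smul, LinearMap.trace_one, smul_eq_mul]
    rw [← hU, sub_mul, mul_assoc A, Units.mul_inv, mul_one, map_sub,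
      LinearMap.trace_mul_comm ℂ ((U : Module.End ℂ (level a (n + 1))) * A), ← mul_assoc, Units.inv_mul, one_mul, sub_self,
      eq_comm, mul_eq_zero] at htr
    rcases htr with h | h
    · have : (n : ℂ) = 1 := by linear_combination -h
      have : n = 1 := by exact_mod_cast this
      omega
    · exact Module.finrank_pos.ne' (by exact_mod_cast h : Module.finrank ℂ (level a (n + 1)) = 0)
  let A := (a 1).restrict fun v (hv : v ∈ level a (n + 1)) => ha.apply_mem_level le_rfl hv
  obtain ⟨w, hw⟩ := Module.End.exists_eigenvalue A
  obtain ⟨⟨v, hv⟩, hvs⟩ := hw.exists_hasEigenvector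
  have hv1 : a 1 v = w • v := congrArg Subtype.val hvs.apply_eq_smul
  have hv0 : v ≠ 0 := fun h => hvs.2 (Subtype.ext h)
  have hv2 : v ∈ level a 2 := fun m hm => hv m (by omega)
  have hsa : a 0 v ≠ 0 ∨ a 1 v ≠ 0 := by
    by_contra! h
    refine hv0 ((Submodule.mem_bot ℂ).1 (h0 ▸ ?_))
    intro m _
    match m with
    | 0 => exact h.1
    | 1 => exact h.2
    | m + 2 => exact hv2 _ (by omega)
  have ha0 : ∀ u, a 0 u ∈ Submodule.span ℂ[X] {u} := fun u => by
    rw [hs u]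
    exact Submodule.add_mem _ (Submodule.smul_mem _ _ (Submodule.mem_span_singleton_self u))
      (Submodule.smul_of_tower_mem _ _ (Submodule.mem_span_singleton_self u))
  have htop : Submodule.span ℂ[X] {v} = ⊤ := by
    refine (hirr _ (ha.isStable_span_singleton (u := v) fun m => ?_)).resolve_left fun h =>
      hv0 (Submodule.span_singleton_eq_bot.1 h)
    match m with
    | 0 => exact ha0 v
    | 1 => rw [hv1]; exact Submodule.smul_of_tower_mem _ _ (Submodule.mem_span_singleton_self v)
    | m + 2 => rw [hv2 _ (by omega)]; exact Submodule.zero_mem _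
  refine ⟨v, w, s, ?_, hv0, htop, hs v, hv1, hv2⟩
  -- For `w = 0` all `aₘ` with `m ≥ 1` kill `v`, and `a₀v = (∂ + s)v` generates a stable submodule.
  -- If it contained `v`, then `q(∂)(∂ + s) - 1` would kill the torsion-free vector `v`, yet this
  -- polynomial is `-1` at `-s`.
  rintro rfl
  rw [zero_smul] at hv1
  have h00 : a 0 v ≠ 0 := hsa.resolve_right (not_not.2 hv1)
  have hl1 : v ∈ level a 1 := fun m hm => by
    rcases hm.eq_or_lt with rfl | hm
    · exact hv1
    · exact hv2 m hm
  have hu : a 0 v = (X + C s : ℂ[X]) • v := by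
    rw [hs, add_smul, ← algebraMap_eq, algebraMap_smul]
  have hst : IsStable a (Submodule.span ℂ[X] {a 0 v}) := by
    refine ha.isStable_span_singleton fun m => ?_
    cases m with
    | zero => exact ha0 _
    | succ m =>
      rw [ha.apply_zero_comm (m + 1), hl1 (m + 1) (by omega), map_zero, smul_zero, sub_zero, zero_add,
        ha.succ_X_smul, hl1 (m + 1) (by omega), smul_zero, zero_add]
      cases m with
      | zero => exact Submodule.mem_span_singleton_self _
      | succ m => rw [hl1 (m + 1) (by omega)]; exact Submodule.zero_mem _
  rcases hirr _ hst with h | h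
  · exact h00 (Submodule.span_singleton_eq_bot.1 h)
  · obtain ⟨q, hq⟩ := Submodule.mem_span_singleton.1 (h ▸ Submodule.mem_top : v ∈ _)
    rw [hu, ← mul_smul] at hq
    refine ha.smul_ne_zero_of_level hl1 h00 (p := q * (X + C s) - 1) (fun h1 => ?_)
      (by rw [sub_smul, hq, one_smul, sub_self])
    have h2 := congrArg (eval (-s)) h1
    simp at h2

end IsVirasoroAction

end CoefficientOperators

/-! ### Polynomials with coefficients in a vector space -/

section Evaluation

variable {V : Type*} [AddCommGroup V] [Module ℂ V]

theorem PolynomialModule.eval_eq_sum_range {p : PolynomialModule ℂ V} {n : ℕ}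
    (h : ∀ m, n ≤ m → p.coeff m = 0) (l : ℂ) :
    p.eval l = ∑ i ∈ Finset.range n, l ^ i • p.coeff i := by
  rw [PolynomialModule.eval_apply]
  refine Finsupp.sum_of_support_subset _ (fun i hi => ?_) _ fun _ _ => smul_zero _
  by_contra hn
  exact Finsupp.mem_support_iff.1 hi (h i (by simpa using hn))

/-- A functional that vanishes on `N` but not on `u i` would turn the sum into a non-zero complex
polynomial vanishing at every point. -/
theorem mem_of_forall_sum_pow_smul_mem (N : Submodule ℂ V) (n : ℕ) (u : ℕ → V)
    (h : ∀ l : ℂ, ∑ i ∈ Finset.range n, l ^ i • u i ∈ N) {i : ℕ} (hi : i < n) : u i ∈ N := by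
  by_contra hu
  obtain ⟨φ, hφ, hN⟩ := Submodule.exists_le_ker_of_notMem hu
  have h0 : (∑ j ∈ Finset.range n, C (φ (u j)) * X ^ j : ℂ[X]) = 0 :=
    Polynomial.funext fun l => by
      have := hN (h l)
      rw [LinearMap.mem_ker, map_sum] at this
      rw [eval_zero, eval_finsetSum, ← this]
      exact Finset.sum_congr rfl fun j _ => by
        rw [eval_C_mul, eval_pow, eval_X, map_smul, smul_eq_mul, mul_comm]
  have h1 := congrArg (fun p => Polynomial.coeff p i) h0
  simp only [finsetSum_coeff, coeff_C_mul_X_pow, coeff_zero] at h1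
  rw [Finset.sum_ite_eq (Finset.range n) i, if_pos (Finset.mem_range.2 hi)] at h1
  exact hφ h1

theorem eq_zero_of_forall_sum_sum_pow_smul {n : ℕ} {u : ℕ → ℕ → V}
    (h : ∀ l m : ℂ, ∑ i ∈ Finset.range n, ∑ j ∈ Finset.range n, (l ^ i * m ^ j) • u i j = 0)
    {i j : ℕ} (hi : i < n) (hj : j < n) : u i j = 0 := by
  have h1 (m : ℂ) : ∑ j ∈ Finset.range n, m ^ j • u i j ∈ (⊥ : Submodule ℂ V) :=
    mem_of_forall_sum_pow_smul_mem ⊥ n (fun i => ∑ j ∈ Finset.range n, m ^ j • u i j)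
      (fun l => by simpa [Finset.smul_sum, smul_smul] using h l m) hi
  exact (Submodule.mem_bot ℂ).1 (mem_of_forall_sum_pow_smul_mem ⊥ n (u i) h1 hj)

theorem PolynomialModule.coeff_mem_of_eval_mem (N : Submodule ℂ V) {p : PolynomialModule ℂ V}
    (h : ∀ l : ℂ, p.eval l ∈ N) (n : ℕ) : p.coeff n ∈ N := by
  obtain ⟨b, hb⟩ := p.coeff.support.bddAbove
  have hp : ∀ m, b + n + 1 ≤ m → p.coeff m = 0 := fun m hm => by
    by_contra hne
    have := hb (Finsupp.mem_support_iff.2 hne)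
    omega
  exact mem_of_forall_sum_pow_smul_mem N (b + n + 1) (fun i => p.coeff i)
    (fun l => by rw [← PolynomialModule.eval_eq_sum_range hp]; exact h l) (by omega)

theorem PolynomialModule.ext_eval {p q : PolynomialModule ℂ V}
    (h : ∀ l : ℂ, p.eval l = q.eval l) : p = q := by
  rw [← sub_eq_zero, ← PolynomialModule.coeff_eq_zero]
  ext n
  exact (Submodule.mem_bot ℂ).1 (PolynomialModule.coeff_mem_of_eval_mem ⊥
    (fun l => by rw [map_sub, h, sub_self]; exact Submodule.zero_mem _) n)

/-- The expansion of `(λ - μ)(λ + μ)ˢ`. -/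
theorem sum_antidiagonal_choose_sub_choose (s : ℕ) (l m : ℂ) :
    ∑ p ∈ Finset.HasAntidiagonal.antidiagonal (s + 1), ((s.choose p.2 : ℂ) - s.choose p.1) * (l ^ p.1 * m ^ p.2) =
      (l - m) * (l + m) ^ s := by
  have h1 : ∑ p ∈ Finset.HasAntidiagonal.antidiagonal (s + 1), (s.choose p.2 : ℂ) * (l ^ p.1 * m ^ p.2) =
      l * (l + m) ^ s := by
    rw [Finset.Nat.sum_antidiagonal_succ, add_comm l m, (Commute.all m l).add_pow',
      Finset.mul_sum, ← Finset.Nat.sum_antidiagonal_swap]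
    simp only [Nat.choose_succ_self, Nat.cast_zero, zero_mul, zero_add, nsmul_eq_mul, Prod.fst_swap,
      Prod.snd_swap]
    exact Finset.sum_congr rfl fun p _ => by ring
  have h2 : ∑ p ∈ Finset.HasAntidiagonal.antidiagonal (s + 1), (s.choose p.1 : ℂ) * (l ^ p.1 * m ^ p.2) =
      m * (l + m) ^ s := by
    rw [Finset.Nat.sum_antidiagonal_succ', (Commute.all l m).add_pow', Finset.mul_sum]
    simp only [Nat.choose_succ_self, Nat.cast_zero, zero_mul, zero_add, nsmul_eq_mul]
    exact Finset.sum_congr rfl fun p _ => by ring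
  simp only [sub_mul, Finset.sum_sub_distrib]
  rw [h1, h2]

end Evaluation

/-! ### Sesquilinearity for polynomials in `∂` -/

namespace ConformalModule

section General

variable {R : Type*} [AddCommGroup R] [Module ℂ R] [Module ℂ[X] R]
    [IsScalarTower ℂ ℂ[X] R] [LieConformalAlgebra R]
    {V : Type*} [AddCommGroup V] [Module ℂ V] [Module ℂ[X] V]
    [IsScalarTower ℂ ℂ[X] V] [ConformalModule R V]

/-- `(f(∂) a)_λ v = f(-λ) a_λ v` -/
theorem eval_act_smul_left (f : ℂ[X]) (a : R) (v : V) (l : ℂ) :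
    (act (f • a) v).eval l = f.eval (-l) • (act a v).eval l := by
  induction f using Polynomial.induction_on with
  | C c => rw [← algebraMap_eq, algebraMap_smul, map_smul, LinearMap.smul_apply, map_smul,
      algebraMap_eq, eval_C]
  | add p q hp hq => rw [add_smul, map_add, LinearMap.add_apply, map_add, hp, hq, eval_add, add_smul]
  | monomial n c h =>
    rw [pow_succ', mul_left_comm, mul_smul, act_d_left, h, smul_smul, eval_mul (p := X), eval_X]

/-- `a_λ (f(∂) v) = f(∂ + λ) a_λ v` -/
theorem eval_act_smul_right (f : ℂ[X]) (a : R) (v : V) (l : ℂ) :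
    (act a (f • v)).eval l = f.comp (X + C l) • (act a v).eval l := by
  induction f using Polynomial.induction_on with
  | C c => rw [← algebraMap_eq, algebraMap_smul, map_smul, map_smul, algebraMap_eq, C_comp,
      ← algebraMap_eq, algebraMap_smul]
  | add p q hp hq => rw [add_smul, map_add, map_add, hp, hq, add_comp, add_smul]
  | monomial n c h =>
    rw [pow_succ', mul_left_comm, mul_smul, act_d_right, h, smul_smul, mul_comp X, X_comp]

end General

end ConformalModule

/-! ### The Virasoro element and the coefficients of its action -/

namespace CVir

open ConformalModule

/-- For `x = f(∂)L` the condition reads `f(-λ)f(∂ + λ)(∂ + 2λ) = (∂ + 2λ)f(∂)`. Setting `λ = 0`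
gives `f(0) = 1`; setting `∂ = 0` then gives `f(-λ)f(λ) = 1`, so `f` is a unit, hence constant. -/
theorem isVirasoroElement_iff (x : CVir) : IsVirasoroElement x ↔ x = L := by
  constructor
  · rintro ⟨hx, h⟩
    let f : ℂ[X] := x
    have hf : f ≠ 0 := hx
    have h' (l : ℂ) : f.comp (-C l) * (f.comp (X + C l) * (X + 2 * C l)) = (X + C (2 * l)) * f := by
      rw [← eval_polyBracket]; exact h l
    have h0 : f.eval 0 = 1 := by
      have := h' 0
      simp only [C_0, neg_zero, add_zero, mul_zero, comp_X, comp_zero] at this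
      have h1 : (C (f.eval 0) - 1) * (f * X) = 0 := by linear_combination this
      rcases mul_eq_zero.1 h1 with h2 | h2
      · exact C_injective (by rw [sub_eq_zero.1 h2, C_1])
      · exact absurd h2 (mul_ne_zero hf X_ne_zero)
    have h1 : f.comp (-X) * f = 1 := by
      refine mul_right_cancel₀ (b := 2 * X) (by simp) ?_
      refine Polynomial.funext fun l => ?_
      have := congrArg (eval 0) (h' l)
      simp only [eval_mul, eval_comp, eval_add, eval_neg, eval_X, eval_C, eval_ofNat, h0, zero_add,
        mul_one] at this
      simp only [eval_mul, eval_comp, eval_neg, eval_X, eval_ofNat, eval_one]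
      linear_combination this
    have hu : IsUnit f := IsUnit.of_mul_eq_one _ (by rw [mul_comm, h1])
    obtain ⟨c, -, hc⟩ := Polynomial.isUnit_iff.1 hu
    have : f = 1 := by rw [← hc, eval_C] at h0; rw [← hc, h0, C_1]
    exact this
  · rintro rfl
    exact ⟨one_ne_zero (α := ℂ[X]), bracket_L_L⟩

theorem smul_L (x : CVir) : (show ℂ[X] from x) • L = x := mul_one (show ℂ[X] from x)

variable {V : Type*} [AddCommGroup V] [Module ℂ V] [Module ℂ[X] V]
    [IsScalarTower ℂ ℂ[X] V] [ConformalModule CVir V]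

variable (V) in
/-- The coefficient of `λⁿ` in the action of `L`. -/
noncomputable def actCoeff (n : ℕ) : V →ₗ[ℂ] V where
  toFun v := (act L v).coeff n
  map_add' v w := by rw [map_add]; rfl
  map_smul' c v := by rw [map_smul]; rfl

theorem actCoeff_apply (n : ℕ) (v : V) : actCoeff V n v = (act L v).coeff n := rfl

theorem exists_actCoeff_eq_zero (v : V) : ∃ n, ∀ m, n ≤ m → actCoeff V m v = 0 := by
  obtain ⟨b, hb⟩ := (act L v).coeff.support.bddAbove
  refine ⟨b + 1, fun m hm => ?_⟩
  by_contra hne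
  have := hb (Finsupp.mem_support_iff.2 hne)
  omega

theorem eval_act_L {v : V} {n : ℕ} (h : ∀ m, n ≤ m → actCoeff V m v = 0) (l : ℂ) :
    (act L v).eval l = ∑ i ∈ Finset.range n, l ^ i • actCoeff V i v :=
  PolynomialModule.eval_eq_sum_range h l

theorem act_L_X_smul (v : V) : act L ((X : ℂ[X]) • v) =
    PolynomialModule.map ℂ (Module.toModuleEnd ℂ V (X : ℂ[X])) (act L v) +
      (X : ℂ[X]) • act L v := by
  refine PolynomialModule.ext_eval fun l => ?_
  rw [act_d_right, map_add, PolynomialModule.eval_map', PolynomialModule.eval_smul, add_smul,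
    ← algebraMap_eq, algebraMap_smul, eval_X]
  rfl

theorem act_L_commutator (v : V) (l m : ℂ) :
    (act L ((act L v).eval m)).eval l - (act L ((act L v).eval l)).eval m =
      (l - m) • (act L v).eval (l + m) := by
  rw [← act_bracket, bracket_L_L, eval_act_smul_left]
  congr 1
  simp
  ring

theorem actCoeff_commutator (i j : ℕ) (v : V) :
    actCoeff V i (actCoeff V j v) - actCoeff V j (actCoeff V i v) =
      (((i + j - 1).choose j : ℂ) - ((i + j - 1).choose i : ℂ)) • actCoeff V (i + j - 1) v := by
  obtain ⟨N, hN⟩ := exists_actCoeff_eq_zero v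
  choose M hM using fun k => exists_actCoeff_eq_zero (actCoeff V k v)
  -- A common bound: all coefficients of `L_λ v` and of `L_λ(aₖv)` vanish from `n` on, the box `n ×
  -- n` contains `(i, j)`, and it contains each antidiagonal `s + 1` with `s < N`.
  set n := N + (Finset.range N).sup M + i + j + 2 with hn
  have hv : ∀ m, n ≤ m → actCoeff V m v = 0 := fun m hm => hN m (by omega)
  have hvv : ∀ k m, n ≤ m → actCoeff V m (actCoeff V k v) = 0 := fun k m hm => by
    rcases lt_or_ge k N with hk | hk
    · have := Finset.le_sup (f := M) (Finset.mem_range.2 hk)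
      exact hM k m (by omega)
    · rw [hN k hk, map_zero]
  have hLL (l m : ℂ) : (act L ((act L v).eval m)).eval l =
      ∑ i ∈ Finset.range n, ∑ j ∈ Finset.range n,
        (l ^ i * m ^ j) • actCoeff V i (actCoeff V j v) := by
    rw [eval_act_L hv m, map_sum, map_sum, Finset.sum_comm]
    refine Finset.sum_congr rfl fun k _ => ?_
    rw [map_smul, map_smul, eval_act_L (hvv k), Finset.smul_sum]
    exact Finset.sum_congr rfl fun k _ => by rw [smul_smul, mul_comm]
  have hR (l m : ℂ) : (l - m) • (act L v).eval (l + m) =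
      ∑ i ∈ Finset.range n, ∑ j ∈ Finset.range n, (l ^ i * m ^ j) •
        (((i + j - 1).choose j : ℂ) - ((i + j - 1).choose i : ℂ)) • actCoeff V (i + j - 1) v := by
    rw [eval_act_L hN, Finset.smul_sum, ← Finset.sum_product']
    have h1 : ∀ s ∈ Finset.range N, (l - m) • (l + m) ^ s • actCoeff V s v =
        ∑ p ∈ Finset.HasAntidiagonal.antidiagonal (s + 1), (l ^ p.1 * m ^ p.2) •
        (((p.1 + p.2 - 1).choose p.2 : ℂ) - ((p.1 + p.2 - 1).choose p.1 : ℂ)) •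
          actCoeff V (p.1 + p.2 - 1) v := fun s _ => by
      rw [smul_smul, ← sum_antidiagonal_choose_sub_choose, Finset.sum_smul]
      refine Finset.sum_congr rfl fun p hp => ?_
      rw [Finset.HasAntidiagonal.mem_antidiagonal.1 hp, Nat.add_sub_cancel, smul_smul, mul_comm]
    rw [Finset.sum_congr rfl h1, Finset.sum_sigma']
    refine Finset.sum_of_injOn (fun x => x.2) ?_ ?_ ?_ fun _ _ => rfl
    · rintro ⟨s, p⟩ hx ⟨s', p'⟩ hx' (rfl : p = p')
      simp only [Finset.coe_sigma, Set.mem_sigma_iff, Finset.mem_coe,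
        Finset.HasAntidiagonal.mem_antidiagonal] at hx hx'
      obtain rfl : s = s' := by omega
      rfl
    · rintro ⟨s, p⟩ hx
      simp only [Finset.coe_sigma, Set.mem_sigma_iff, Finset.mem_coe, Finset.mem_range,
        Finset.HasAntidiagonal.mem_antidiagonal] at hx
      simp only [Finset.coe_product, Set.mem_prod, Finset.mem_coe, Finset.mem_range]
      omega
    -- Pairs off these antidiagonals contribute nothing: at `(0, 0)`, where `i + j - 1` truncates to
    -- `0`, the binomials cancel; otherwise `i + j - 1 ≥ N`.
    · rintro ⟨i, j⟩ - hij
      rcases Nat.eq_zero_or_pos (i + j) with h0 | h0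
      · obtain ⟨rfl, rfl⟩ : i = 0 ∧ j = 0 := by omega
        simp
      · rw [hN (i + j - 1), smul_zero, smul_zero]
        by_contra! hlt
        refine hij ⟨⟨i + j - 1, (i, j)⟩, ?_, rfl⟩
        simp only [Finset.coe_sigma, Set.mem_sigma_iff, Finset.mem_coe, Finset.mem_range,
          Finset.HasAntidiagonal.mem_antidiagonal]
        omega
  rw [← sub_eq_zero]
  refine eq_zero_of_forall_sum_sum_pow_smul (n := n) (u := fun i j =>
    actCoeff V i (actCoeff V j v) - actCoeff V j (actCoeff V i v) -
      (((i + j - 1).choose j : ℂ) - ((i + j - 1).choose i : ℂ)) • actCoeff V (i + j - 1) v)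
    (fun l m => ?_) (by omega) (by omega)
  simp only [smul_sub, Finset.sum_sub_distrib]
  have hLL' : (act L ((act L v).eval l)).eval m = ∑ i ∈ Finset.range n, ∑ j ∈ Finset.range n,
      (l ^ i * m ^ j) • actCoeff V j (actCoeff V i v) := by
    rw [hLL, Finset.sum_comm]
    simp only [mul_comm]
  rw [← hR, ← act_L_commutator, ← hLL, ← hLL', sub_self]

variable (V) in
theorem isVirasoroAction : IsVirasoroAction (actCoeff V) where
  eventually_zero := exists_actCoeff_eq_zero
  zero_X_smul v := by
    rw [actCoeff_apply, act_L_X_smul, PolynomialModule.coeff_add, Finsupp.add_apply,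
      ← monomial_one_one_eq_X, PolynomialModule.monomial_smul_apply]
    exact add_zero _
  succ_X_smul n v := by
    rw [actCoeff_apply, act_L_X_smul, PolynomialModule.coeff_add, Finsupp.add_apply,
      ← monomial_one_one_eq_X, PolynomialModule.monomial_smul_apply, if_pos (by omega), one_smul]
    rfl
  commutator := actCoeff_commutator

theorem isConformalSubmodule_iff (N : Submodule ℂ[X] V) :
    IsConformalSubmodule CVir N ↔ IsVirasoroAction.IsStable (actCoeff V) N := by
  refine ⟨fun h n v hv => h L v hv n, fun h x v hv n => ?_⟩
  refine PolynomialModule.coeff_mem_of_eval_mem (N.restrictScalars ℂ) (fun l => ?_) n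
  obtain ⟨b, hb⟩ := exists_actCoeff_eq_zero v
  rw [← smul_L x, eval_act_smul_left, eval_act_L hb]
  exact Submodule.smul_mem _ _ (Submodule.sum_mem _ fun i _ => Submodule.smul_mem _ _ (h i v hv))

theorem isTrivialOn_iff (N : Submodule ℂ[X] V) :
    IsTrivialOn CVir N ↔ ∀ n, ∀ v ∈ N, actCoeff V n v = 0 := by
  refine ⟨fun h n v hv => by rw [actCoeff_apply, h L v hv]; rfl, fun h x v hv => ?_⟩
  have h0 : act L v = 0 := by
    rw [← PolynomialModule.coeff_eq_zero]
    ext n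
    exact h n v hv
  refine PolynomialModule.ext_eval fun l => ?_
  rw [← smul_L x, eval_act_smul_left, h0, map_zero, smul_zero]

/-- The action `L_λ v = (∂ + w λ + s) v` in terms of coefficients. -/
theorem eval_act_L_eq_iff (v : V) (w s : ℂ) :
    (∀ l : ℂ, (act L v).eval l = (X + C (w * l + s) : ℂ[X]) • v) ↔
      actCoeff V 0 v = (X : ℂ[X]) • v + s • v ∧ actCoeff V 1 v = w • v ∧
        v ∈ IsVirasoroAction.level (actCoeff V) 2 := by
  have hC (c : ℂ) : (C c : ℂ[X]) • v = c • v := by rw [← algebraMap_eq, algebraMap_smul]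
  constructor
  · intro h
    have h1 : act L v = PolynomialModule.single ℂ 0 ((X : ℂ[X]) • v + s • v) +
        PolynomialModule.single ℂ 1 (w • v) := PolynomialModule.ext_eval fun l => by
      rw [h, map_add (PolynomialModule.eval l), PolynomialModule.eval_single,
        PolynomialModule.eval_single, add_smul, hC]
      module
    refine ⟨?_, ?_, fun m hm => ?_⟩
    · rw [actCoeff_apply, h1]; simp
    · rw [actCoeff_apply, h1]; simp
    · rw [actCoeff_apply, h1]
      simp [show 0 ≠ m by omega, show 1 ≠ m by omega]
  · rintro ⟨h0, h1, h2⟩ l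
    rw [eval_act_L h2, Finset.sum_range_succ, Finset.sum_range_one, h0, h1, add_smul, hC]
    module

end CVir

namespace CVir

open ConformalModule IsVirasoroAction

variable {V : Type*} [AddCommGroup V] [Module ℂ V] [Module ℂ[X] V]
    [IsScalarTower ℂ ℂ[X] V] [ConformalModule CVir V]

/-! ### Regular bases -/

/-- The action of `L` in the coordinates of a regular basis. -/
theorem repr_eval_act_L {ι : Type*} [Fintype ι] (b : Module.Basis ι ℂ[X] V) (w s : ι → ℂ)
    (h : ∀ i (l : ℂ), (act L (b i)).eval l = (X + C (w i * l + s i) : ℂ[X]) • b i)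
    (v : V) (l : ℂ) (i : ι) :
    b.repr ((act L v).eval l) i = (b.repr v i).comp (X + C l) * (X + C (w i * l + s i)) := by
  conv_lhs => rw [← b.sum_repr v]
  rw [map_sum, map_sum]
  simp only [eval_act_smul_right, h, smul_smul]
  exact b.repr_sum_self _ ▸ rfl

/-- The base change matrix satisfies `D(λ)P(∂ + λ) = P(∂)D'(λ)` with `D`, `D'` diagonal. Its
determinant is a unit of `ℂ[∂]`, so a constant unaffected by the shift, and cancels: `det D = det
D'`. At `∂ = 0` the top coefficients in `λ` are the two products. -/
theorem prod_weight_eq {ι : Type*} [Fintype ι] (b b' : Module.Basis ι ℂ[X] V) (w s w' s' : ι → ℂ)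
    (h : ∀ i (l : ℂ), (act L (b i)).eval l = (X + C (w i * l + s i) : ℂ[X]) • b i)
    (h' : ∀ i (l : ℂ), (act L (b' i)).eval l = (X + C (w' i * l + s' i) : ℂ[X]) • b' i) :
    ∏ i, w i = ∏ i, w' i := by
  classical
  let P : Matrix ι ι ℂ[X] := b.toMatrix b'
  have hP : IsUnit P.det := (Matrix.isUnit_iff_isUnit_det _).1
    (@isUnit_of_invertible _ _ _ (b.invertibleToMatrix b'))
  obtain ⟨c, hc, hcP⟩ := Polynomial.isUnit_iff.1 hP
  have key (l : ℂ) : ∏ i, (X + C (w i * l + s i)) = ∏ i, (X + C (w' i * l + s' i)) := by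
    have hM : Matrix.diagonal (fun i => X + C (w i * l + s i)) *
        (compRingHom (X + C l)).mapMatrix P =
          P * Matrix.diagonal (fun i => X + C (w' i * l + s' i)) := by
      ext1 i j
      rw [Matrix.diagonal_mul, Matrix.mul_diagonal]
      have := repr_eval_act_L b w s h (b' j) l i
      rw [h', map_smul, Finsupp.smul_apply, smul_eq_mul] at this
      simp only [RingHom.mapMatrix_apply, Matrix.map_apply, coe_compRingHom_apply, P,
        Module.Basis.toMatrix_apply]
      rw [mul_comm, ← this, mul_comm]
    have hdet := congrArg Matrix.det hM
    rw [Matrix.det_mul, Matrix.det_mul, Matrix.det_diagonal, Matrix.det_diagonal,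
      ← RingHom.map_det, ← hcP, coe_compRingHom_apply, C_comp, mul_comm] at hdet
    exact mul_left_cancel₀ (C_ne_zero.2 hc.ne_zero) hdet
  have hpoly : ∏ i, (C (w i) * X + C (s i)) = ∏ i, (C (w' i) * X + C (s' i)) :=
    Polynomial.funext fun l => by
      have := congrArg (eval 0) (key l)
      simpa [eval_prod] using this
  have h1 := congrArg (fun p => coeff p (Fintype.card ι * 1)) hpoly
  simp only [Fintype.card] at h1
  rw [coeff_prod_of_natDegree_le _ _ _ fun _ _ => natDegree_linear_le,
    coeff_prod_of_natDegree_le _ _ _ fun _ _ => natDegree_linear_le] at h1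
  simpa using h1

section Finite

variable [Module.Finite ℂ[X] V]

theorem finite_carrier (Y : RegularBasis V L) : Finite Y.carrier :=
  Module.Finite.finite_basis Y.basis

theorem finprod_weight_eq (Y Y' : RegularBasis V L) :
    ∏ᶠ y, Y.weight y = ∏ᶠ y, Y'.weight y := by
  have := finite_carrier Y
  have := finite_carrier Y'
  have := Fintype.ofFinite Y.carrier
  have := Fintype.ofFinite Y'.carrier
  let e := Y.basis.indexEquiv Y'.basis
  rw [finprod_eq_prod_of_fintype, finprod_eq_prod_of_fintype, ← e.prod_comp]
  refine prod_weight_eq Y.basis (Y'.basis.reindex e.symm) Y.weight Y.shift _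
    (fun i => Y'.shift (e i)) (fun i l => ?_) (fun i l => ?_)
  · rw [Y.basis_apply, Y.act_eq]
  · rw [Module.Basis.reindex_apply, e.symm_symm, Y'.basis_apply, Y'.act_eq]

theorem isConformalWeightProduct_iff (Y : RegularBasis V L) (p : ℂ) :
    IsConformalWeightProduct CVir V p ↔ p = ∏ᶠ y, Y.weight y := by
  have hΓ : regularVirasoroElements CVir V = {L} := by
    ext x
    refine ⟨fun hx => (isVirasoroElement_iff x).1 hx.1, ?_⟩
    rintro rfl
    exact ⟨(isVirasoroElement_iff _).2 rfl, ⟨Y⟩⟩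
  have hL : ∀ x : regularVirasoroElements CVir V, L = (x : CVir) := fun x =>
    ((isVirasoroElement_iff _).1 x.2.1).symm
  let i : Unique (regularVirasoroElements CVir V) :=
    { default := ⟨L, hΓ ▸ rfl⟩, uniq := fun x => Subtype.ext (hL x).symm }
  constructor
  · rintro ⟨-, Z, -, rfl⟩
    rw [finprod_unique]
    exact finprod_weight_eq (Z default) Y
  · rintro rfl
    -- The type of a regular basis depends on `x`, so `Y` is transported along `L = x`. The basis
    -- chosen at `L` need not be `Y`, whence the final appeal to `finprod_weight_eq`.
    have Z (x : CVir) (hx : L = x) : ∃ Z : RegularBasis V x, Z.carrier.Finite := by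
      subst hx
      exact ⟨Y, finite_carrier Y⟩
    choose Z hZ using Z
    refine ⟨hΓ ▸ Set.finite_singleton L, fun x => Z x (hL x), fun x => hZ x (hL x), ?_⟩
    exact (finprod_weight_eq Y (Z L rfl)).trans (finprod_unique
      fun x : regularVirasoroElements CVir V => ∏ᶠ y, (Z x (hL x)).weight y).symm

theorem finprod_weight_ne_zero_iff (Y : RegularBasis V L) :
    ∏ᶠ y, Y.weight y ≠ 0 ↔ ∀ y, Y.weight y ≠ 0 := by
  have := finite_carrier Y
  have := Fintype.ofFinite Y.carrier
  rw [finprod_eq_prod_of_fintype, Finset.prod_ne_zero_iff]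
  simp

/-! ### From regular bases to semisimplicity -/

/-- At `λ = 0` the action multiplies the `i`-th coordinate by the non-zero polynomial `∂ + αᵢ`, so
it is injective, whatever the weights. -/
theorem not_isTrivialOn_of_regularBasis (Y : RegularBasis V L) {N : Submodule ℂ[X] V}
    (hN : N ≠ ⊥) : ¬ IsTrivialOn CVir N := fun h => by
  have := finite_carrier Y
  have := Fintype.ofFinite Y.carrier
  refine hN ((Submodule.eq_bot_iff _).2 fun v hv => ?_)
  rw [← Y.basis.repr.map_eq_zero_iff]
  ext1 i
  have h1 := repr_eval_act_L Y.basis Y.weight Y.shift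
    (fun i l => by rw [Y.basis_apply, Y.act_eq]) v 0 i
  rw [h L v hv, map_zero, map_zero, Finsupp.zero_apply, eq_comm, mul_eq_zero, C_0, add_zero,
    comp_X] at h1
  exact h1.resolve_right (X_add_C_ne_zero _)

end Finite

theorem isIrreducibleSubmodule_span_singleton {v : V} {w s : ℂ} (hv : v ≠ 0) (hw : w ≠ 0)
    (h : ∀ l : ℂ, (act L v).eval l = (X + C (w * l + s) : ℂ[X]) • v) :
    IsIrreducibleSubmodule CVir (Submodule.span ℂ[X] {v}) := by
  have ha := isVirasoroAction V
  obtain ⟨h0, h1, h2⟩ := (eval_act_L_eq_iff v w s).1 h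
  refine ⟨?_, by simpa using hv, fun M hM hle => ?_⟩
  · rw [isConformalSubmodule_iff]
    have hmem := Submodule.mem_span_singleton_self (R := ℂ[X]) v
    refine ha.isStable_span_singleton fun m => ?_
    match m with
    | 0 =>
      rw [h0]
      exact Submodule.add_mem _ (Submodule.smul_mem _ _ hmem) (Submodule.smul_of_tower_mem _ _ hmem)
    | 1 => rw [h1]; exact Submodule.smul_of_tower_mem _ _ hmem
    | m + 2 => rw [h2 _ (by omega)]; exact Submodule.zero_mem _
  · rw [isConformalSubmodule_iff] at hM
    refine or_iff_not_imp_left.2 fun hne => le_antisymm hle ?_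
    obtain ⟨x, hx, hx0⟩ := (Submodule.ne_bot_iff _).1 hne
    obtain ⟨p, rfl⟩ := Submodule.mem_span_singleton.1 (hle hx)
    -- This is the factor by which the coefficient of `λ^(1 + deg p)` in `L_λ(p(∂)v)` multiplies
    -- `v`; inverting it puts `v` into `M`.
    have hp : p.leadingCoeff * w ≠ 0 :=
      mul_ne_zero (leadingCoeff_ne_zero.2 fun hp => hx0 (by rw [hp, zero_smul])) hw
    have hmem := hM (1 + p.natDegree) _ hx
    rw [(ha.apply_smul_top h2 p le_rfl).1, h1, smul_smul] at hmem
    have := Submodule.smul_of_tower_mem M (p.leadingCoeff * w)⁻¹ hmem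
    rw [coeff_natDegree, smul_smul, inv_mul_cancel₀ hp, one_smul] at this
    exact (Submodule.span_singleton_le_iff_mem _ _).2 this

theorem isSemisimple_of_regularBasis (Y : RegularBasis V L) (hY : ∀ y, Y.weight y ≠ 0) :
    IsSemisimple CVir V := by
  refine ⟨Set.range fun y => Submodule.span ℂ[X] {Y.basis y}, ?_, ?_, ?_⟩
  · rintro _ ⟨y, rfl⟩
    refine isIrreducibleSubmodule_span_singleton (Y.basis.ne_zero y) (hY y) (s := Y.shift y)
      fun l => ?_
    rw [Y.basis_apply, Y.act_eq]
  · exact Y.basis.linearIndependent.iSupIndep_span_singleton.sSupIndep_range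
  · rw [sSup_range, ← Submodule.span_range_eq_iSup, Y.basis.span_eq]

/-! ### From semisimplicity to regular bases -/

/-- A non-trivial irreducible conformal submodule is free of rank one. -/
theorem exists_generator [Module.Finite ℂ[X] V] {N : Submodule ℂ[X] V}
    (hN : IsIrreducibleSubmodule CVir N) (hnt : ¬ IsTrivialOn CVir N) :
    ∃ (v : V) (w s : ℂ), w ≠ 0 ∧ Submodule.span ℂ[X] {v} = N ∧
      (∀ p : ℂ[X], p ≠ 0 → p • v ≠ 0) ∧
      ∀ l : ℂ, (act L v).eval l = (X + C (w * l + s) : ℂ[X]) • v := by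
  obtain ⟨hst, hne, hirr⟩ := hN
  rw [isConformalSubmodule_iff] at hst
  have ha := isVirasoroAction V
  let a (n : ℕ) : N →ₗ[ℂ] N :=
    { toFun := fun v => ⟨actCoeff V n v, hst n v v.2⟩
      map_add' := fun v w => Subtype.ext (map_add (actCoeff V n) (v : V) w)
      map_smul' := fun c v => Subtype.ext (map_smul (actCoeff V n) c (v : V)) }
  have haN : IsVirasoroAction a :=
    { eventually_zero := fun v => by
        obtain ⟨n, hn⟩ := ha.eventually_zero v
        exact ⟨n, fun m hm => Subtype.ext (hn m hm)⟩
      zero_X_smul := fun v => Subtype.ext (ha.zero_X_smul v)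
      succ_X_smul := fun n v => Subtype.ext (ha.succ_X_smul n v)
      commutator := fun i j v => Subtype.ext (ha.commutator i j v) }
  obtain ⟨v, w, s, hw, hv0, hspan, h0, h1, h2⟩ := haN.exists_generator_of_irreducible
    (by
      by_contra! hcon
      exact hnt ((isTrivialOn_iff N).2 fun n v hv => congrArg Subtype.val (hcon n ⟨v, hv⟩)))
    (fun M hM => by
      have hmap : IsConformalSubmodule CVir (M.map N.subtype) := by
        rw [isConformalSubmodule_iff]
        rintro n _ ⟨x, hx, rfl⟩
        exact ⟨a n x, hM n x hx, rfl⟩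
      refine (hirr _ hmap (Submodule.map_subtype_le N M)).imp (fun h => ?_) fun h => ?_
      · exact Submodule.map_injective_of_injective N.injective_subtype (by rw [h, Submodule.map_bot])
      · refine Submodule.map_injective_of_injective N.injective_subtype ?_
        rw [h, Submodule.map_subtype_top])
  have hv2 : (v : V) ∈ level (actCoeff V) 2 := fun m hm => congrArg Subtype.val (h2 m hm)
  have hv1 : actCoeff V 1 v = w • (v : V) := congrArg Subtype.val h1
  refine ⟨v, w, s, hw, ?_, fun p hp => ?_, ?_⟩
  · have := congrArg (Submodule.map N.subtype) hspan
    rwa [Submodule.map_span, Set.image_singleton, Submodule.map_subtype_top] at this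
  · refine ha.smul_ne_zero_of_level hv2 ?_ hp
    rw [hv1]
    exact smul_ne_zero hw fun h => hv0 (Subtype.ext h)
  · exact (eval_act_L_eq_iff _ _ _).2 ⟨congrArg Subtype.val h0, hv1, hv2⟩

theorem exists_regularBasis_of_isSemisimple [Module.Finite ℂ[X] V] (hss : IsSemisimple CVir V)
    (hnt : ∀ N : Submodule ℂ[X] V, IsIrreducibleSubmodule CVir N → ¬ IsTrivialOn CVir N) :
    ∃ Y : RegularBasis V L, ∀ y, Y.weight y ≠ 0 := by
  obtain ⟨S, hS, hind, htop⟩ := hss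
  choose v w s hw hspan htf hact using
    fun N : S => exists_generator (hS N N.2) (hnt N (hS N N.2))
  -- The spans are independent because the sum is direct, and each generator is torsion-free.
  have hli : LinearIndependent ℂ[X] v := by
    refine Ideal.iSupIndep.linearIndependent' ?_ fun N => ?_
    · simp only [hspan]
      exact (sSupIndep_iff S).1 hind
    · refine (Submodule.eq_bot_iff _).2 fun p hp => ?_
      by_contra hp0
      exact htf N p hp0 ((Ideal.mem_torsionOf_iff _ _).1 hp)
  let b : Module.Basis S ℂ[X] V := Module.Basis.mk hli (by
    rw [Submodule.span_range_eq_iSup]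
    simp only [hspan]
    rw [← sSup_eq_iSup', htop])
  have hb : ∀ N, b N = v N := fun N => Module.Basis.mk_apply _ _ N
  choose i hi using fun y : Set.range b => y.2
  refine ⟨{
    carrier := Set.range b
    basis := b.reindexRange
    basis_apply := fun y => b.reindexRange_apply y
    weight := fun y => w (i y)
    shift := fun y => s (i y)
    act_eq := fun y l => ?_ }, fun y => hw _⟩
  rw [← hi y, hb, hact]

end CVir

theorem theorem2p5 :
    -- `L` is the unique Virasoro element of the Virasoro conformal algebra
    (∀ x : CVir, ConformalModule.IsVirasoroElement x ↔ x = CVir.L) ∧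
    ∀ (V : Type*) [AddCommGroup V] [Module ℂ V] [Module ℂ[X] V] [IsScalarTower ℂ ℂ[X] V]
      [ConformalModule CVir V] [Module.Finite ℂ[X] V],
      -- the conformal weight product is well defined once the action of `L` is regular
      (ConformalModule.IsRegularAction V CVir.L →
        ∃! p : ℂ, ConformalModule.IsConformalWeightProduct CVir V p) ∧
      -- the semisimplicity criterion
      ((ConformalModule.IsSemisimple CVir V ∧
          ∀ N : Submodule ℂ[X] V, ConformalModule.IsIrreducibleSubmodule CVir N →
            ¬ ConformalModule.IsTrivialOn CVir N) ↔
        (ConformalModule.IsRegularAction V CVir.L ∧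
          ∃ p : ℂ, ConformalModule.IsConformalWeightProduct CVir V p ∧ p ≠ 0)) := by
  refine ⟨CVir.isVirasoroElement_iff, fun V _ _ _ _ _ _ => ⟨?_, ?_, ?_⟩⟩
  · rintro ⟨Y⟩
    exact ⟨_, (CVir.isConformalWeightProduct_iff Y _).2 rfl,
      fun p hp => (CVir.isConformalWeightProduct_iff Y p).1 hp⟩
  · rintro ⟨hss, hnt⟩
    obtain ⟨Y, hY⟩ := CVir.exists_regularBasis_of_isSemisimple hss hnt
    exact ⟨⟨Y⟩, _, (CVir.isConformalWeightProduct_iff Y _).2 rfl,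
      (CVir.finprod_weight_ne_zero_iff Y).2 hY⟩
  · rintro ⟨⟨Y⟩, p, hp, hp0⟩
    rw [CVir.isConformalWeightProduct_iff Y] at hp
    rw [hp, CVir.finprod_weight_ne_zero_iff] at hp0
    exact ⟨CVir.isSemisimple_of_regularBasis Y hp0,
      fun N hN => CVir.not_isTrivialOn_of_regularBasis Y hN.2.1⟩
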